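/- Let $X$ be a Cantor set (a nonempty compact metrizable totally disconnected space without isolated points), let $n \geq 3$ be odd, and let $\alpha : X \to X$ and $\beta : S^n \to S^n$ be homeomorphisms such that the product homeomorphism $\alpha \times \beta : X \times S^n \to X \times S^n$, $(\alpha\times\beta)(x,z) = (\alpha(x),\beta(z))$, is minimal, i.e. every orbit $\{(\alpha\times\beta)^k(w) : k \in \mathbb{Z}\}$ is dense. Let $A = \mathcal{C}(X \times S^n) \rtimes_{\alpha \times \beta} \mathbb{Z}$ be the crossed product $\mathrm{C}^*$-algebra, with canonical unitary $u$ satisfying $u f u^* = f \circ (\alpha\times\beta)^{-1}$ for $f \in \mathcal{C}(X \times S^n)$. For $y \in X$ let $$A_{\{y\}} = \mathrm{C}^*\bigl(\mathcal{C}(X \times S^n),\, u\,\mathcal{C}_0((X \setminus \{y\}) \times S^n)\bigr) \subseteq A$$ be the orbit-breaking subalgebra at the fibre $\{y\}\times S^n$, with inclusion $\iota : A_{\{y\}} \to A$. For a unital $\mathrm{C}^*$-algebra $B$ let $T(B)$ denote the set of tracial states on $B$. Then, for every $y \in X$, every tracial state $\tau \in T(A_{\{y\}})$ satisfies $$\tau(f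 \circ (\alpha\times\beta)^{-1}) = \tau(f) \quad\text{for all } f \in \mathcal{C}(X \times S^n).$$ In particular, the map $\tau \mapsto \tau \circ \iota$ is a bijection from $T(A)$ onto $T(A_{\{y\}})$. -/

import Mathlib

open scoped ENNReal ComplexOrder

universe u

noncomputable section

/-- A self-homeomorphism `h` is minimal if the orbit `{h ^ k w : k ∈ ℤ}` of every point `w`
is dense. -/
def IsMinimalHomeo {W : Type u} [TopologicalSpace W] (h : W ≃ₜ W) : Prop :=
  ∀ w : W, Dense (Set.range fun k : ℤ => (h ^ k) w)

/-- A covariant pair for `(W, h)` in a nonzero unital C⋆-algebra `B`: a unital ⋆-homomorphism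
`π : C(W) → B` and a unitary `U` with `U π(f) U⋆ = π(f ∘ h⁻¹)`. Taking for `B` the bounded operators
of a Hilbert space one gets the covariant representations of `(W, h)`. -/
structure CovariantPair {W : Type u} [TopologicalSpace W] (h : W ≃ₜ W) : Type (u + 1) where
  B : Type u
  [cstar : CStarAlgebra B]
  [nontrivial : Nontrivial B]
  π : C(W, ℂ) →⋆ₐ[ℂ] B
  U : unitary B
  covariant : ∀ f : C(W, ℂ), (U : B) * π f * star (U : B) = π (f.comp (h.symm : C(W, W)))

attribute [instance] CovariantPair.cstar CovariantPair.nontrivial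

/-- The ℓ^∞-product of a family of nonzero unital C⋆-algebras is a unital C⋆-algebra. -/
instance lpInftyCStarAlgebra {I : Type*} {B : I → Type*} [∀ i, CStarAlgebra (B i)]
    [∀ i, Nontrivial (B i)] : CStarAlgebra (lp B ∞) where

/-- The C⋆-subalgebra `C⋆(s)` of a unital C⋆-algebra generated by `s` and the unit: the closure of
the unital ⋆-subalgebra generated by `s`. -/
def cstarGenerated {A : Type*} [CStarAlgebra A] (s : Set A) : StarSubalgebra ℂ A :=
  (StarAlgebra.adjoin ℂ s).topologicalClosure

theorem subset_cstarGenerated {A : Type*} [CStarAlgebra A] (s : Set A) :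
    s ⊆ cstarGenerated s :=
  (StarAlgebra.subset_adjoin ℂ s).trans
    (StarSubalgebra.le_topologicalClosure (StarAlgebra.adjoin ℂ s))

instance cstarGeneratedCStarAlgebra {A : Type*} [CStarAlgebra A] (s : Set A) :
    CStarAlgebra (cstarGenerated s) :=
  StarSubalgebra.cstarAlgebra (cstarGenerated s)
    (h_closed := StarSubalgebra.isClosed_topologicalClosure _)

/-- A tracial state on a unital C⋆-algebra `B`: a positive (bounded) linear functional `τ` with
`τ 1 = 1` and `τ (a b) = τ (b a)`. -/
@[ext]
structure TracialState (B : Type*) [CStarAlgebra B] where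
  functional : B →L[ℂ] ℂ
  nonneg : ∀ a : B, 0 ≤ functional (star a * a)
  map_one : functional 1 = 1
  map_mul_comm : ∀ a b : B, functional (a * b) = functional (b * a)

instance TracialState.coeFun (B : Type*) [CStarAlgebra B] :
    CoeFun (TracialState B) (fun _ => B → ℂ) :=
  ⟨fun τ => τ.functional⟩

/-- The restriction `τ ∘ ι` of a tracial state of `A` to the C⋆-subalgebra `C⋆(s)`, where
`ι : C⋆(s) → A` is the inclusion. -/
def TracialState.restrict {A : Type*} [CStarAlgebra A] (s : Set A) (τ : TracialState A) :
    TracialState (cstarGenerated s) where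
  functional := τ.functional.comp
    ⟨(cstarGenerated s).subtype.toAlgHom.toLinearMap, continuous_subtype_val⟩
  nonneg a := τ.nonneg (a : A)
  map_one := τ.map_one
  map_mul_comm a b := τ.map_mul_comm (a : A) (b : A)

section CrossedProduct

variable {W : Type u} [TopologicalSpace W] [CompactSpace W] (h : W ≃ₜ W)

/-- The ℓ^∞-product of the targets of all covariant pairs for `(W, h)`. -/
abbrev CovariantProduct : Type (u + 1) := lp (fun p : CovariantPair h => p.B) ∞

/-- The image of `f ∈ C(W)` under the product of all covariant pairs. -/
def universalFn (f : C(W, ℂ)) : CovariantProduct h :=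
  ⟨fun p => p.π f, memℓp_infty ⟨‖f‖, by
    rintro _ ⟨p, rfl⟩
    exact NonUnitalStarAlgHom.norm_apply_le p.π f⟩⟩

/-- The unitary of the product of all covariant pairs. -/
def universalUnitary : CovariantProduct h :=
  ⟨fun p => (p.U : p.B), memℓp_infty ⟨1, by
    rintro _ ⟨p, rfl⟩
    exact (CStarRing.norm_coe_unitary p.U).le⟩⟩

/-- The (full) crossed product C⋆-algebra `C(W) ⋊_h ℤ`: the C⋆-subalgebra of the product of all
covariant pairs that is generated by the images of `C(W)` and of the unitary. It is the universal
C⋆-algebra generated by `C(W)` and a unitary `u` with `u f u⋆ = f ∘ h⁻¹`: the coordinate projections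
give the ⋆-homomorphisms to the covariant pairs. -/
def CrossedProduct : Type (u + 1) :=
  cstarGenerated (Set.range (universalFn h) ∪ {universalUnitary h})

instance crossedProductCStarAlgebra : CStarAlgebra (CrossedProduct h) :=
  cstarGeneratedCStarAlgebra _

/-- The canonical embedding of `C(W)` in `C(W) ⋊_h ℤ`. -/
def CrossedProduct.fn (f : C(W, ℂ)) : CrossedProduct h :=
  ⟨universalFn h f, subset_cstarGenerated _ (Or.inl ⟨f, rfl⟩)⟩

/-- The canonical unitary `u` of `C(W) ⋊_h ℤ`. -/
def CrossedProduct.u : CrossedProduct h :=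
  ⟨universalUnitary h, subset_cstarGenerated _ (Or.inr rfl)⟩

/-- The generators `C(W) ∪ u C₀(W ∖ Z)` of the orbit-breaking subalgebra at a closed set `Z ⊆ W`. As
`W` is compact, `C₀(W ∖ Z)` consists of the continuous functions on `W` that vanish on `Z`. -/
def orbitBreakingGenerators (Z : Set W) : Set (CrossedProduct h) :=
  Set.range (CrossedProduct.fn h) ∪
    {a | ∃ f : C(W, ℂ), (∀ w ∈ Z, f w = 0) ∧
      a = CrossedProduct.u h * CrossedProduct.fn h f}

/-- The orbit-breaking subalgebra `C⋆(C(W), u C₀(W ∖ Z))` of `C(W) ⋊_h ℤ`, for `Z ⊆ W` closed. -/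
abbrev OrbitBreaking (Z : Set W) : Type (u + 1) :=
  cstarGenerated (orbitBreakingGenerators h Z)

/-- The canonical embedding of `C(W)` in the orbit-breaking subalgebra. -/
def OrbitBreaking.fn (Z : Set W) (f : C(W, ℂ)) : OrbitBreaking h Z :=
  ⟨CrossedProduct.fn h f, subset_cstarGenerated _ (Or.inl ⟨f, rfl⟩)⟩

/-- The restriction map `T(C(W) ⋊_h ℤ) → T(C⋆(C(W), u C₀(W ∖ Z)))`, `τ ↦ τ ∘ ι`. -/
def OrbitBreaking.restrictTrace (Z : Set W) :
    TracialState (CrossedProduct h) → TracialState (OrbitBreaking h Z) :=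
  TracialState.restrict (orbitBreakingGenerators h Z)

end CrossedProduct

/-- The unit sphere `S^n` in `ℝ^(n+1)`. -/
abbrev Sphere (n : ℕ) : Type := Metric.sphere (0 : EuclideanSpace ℝ (Fin (n + 1))) 1

/-- The set `Y × S` over `Y ⊆ X` in the product `X × S`. -/
def fibreOver {X : Type*} (S : Type*) (Y : Set X) : Set (X × S) := Y ×ˢ Set.univ

end

/-! Write `h` for the product homeomorphism. A trace on the orbit-breaking algebra is invariant on
products `f * g` of functions vanishing on the fibre: `a = u f` and `b = u (star g)` lie in the
algebra, `a b⋆ = (f g) ∘ h⁻¹` and `b⋆ a = f g` (`OrbitBreaking.trace_twist_one_of_vanishing`).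

The mass near the fibre is controlled by towers. Minimality makes `α` aperiodic, since a periodic
point would have a finite dense orbit in a perfect space. Hence `y` has clopen neighbourhoods `P`
with `P, α P, …, α ^ N P` disjoint. Let `p` be the indicator of `P × S^n`. Invariance can only break
when a translate of `f p` crosses the fibre, so `f p` has the same trace as its `N` backward
translates, and its first forward translate the same trace as the next `N`. Each of these two
families of `N + 1` functions is disjointly supported, with sum of norm at most `‖f‖`, so both
traces are `O(1 / N)` and the defect of invariance is zero (`twist_one_invariant_of_towers`).

For the bijection, freeness forces traces on either algebra to vanish on `f u ^ n` with `n ≠ 0`, so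
they are determined on `C(W)` (`TracialState.ext_of_fn`). Conversely an invariant state `φ` of
`C(W)` extends to the trace `φ ∘ E` (`CrossedProduct.inducedTrace`), where the conditional
expectation `E` is read off the regular representations on `ℓ²(ℤ)` along orbits. -/

noncomputable section

/-! ### Translates of functions, the tower estimate, and freeness killing traces. -/

section Twist

variable {W : Type*} [TopologicalSpace W] (h : W ≃ₜ W)

/-- The automorphism `f ↦ f ∘ h ^ (-n)` of `C(W)`. -/
def twist (n : ℤ) : C(W, ℂ) →⋆ₐ[ℂ] C(W, ℂ) :=
  ContinuousMap.compStarAlgHom' ℂ ℂ ((h ^ (-n) : W ≃ₜ W) : C(W, W))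

@[simp]
theorem twist_apply (n : ℤ) (f : C(W, ℂ)) (w : W) : twist h n f w = f ((h ^ (-n)) w) := rfl

theorem twist_zero (f : C(W, ℂ)) : twist h 0 f = f := by
  ext w
  simp

theorem twist_twist (m n : ℤ) (f : C(W, ℂ)) : twist h m (twist h n f) = twist h (m + n) f := by
  ext w
  simp only [twist_apply]
  rw [← Homeomorph.mul_apply, ← zpow_add, neg_add, add_comm]

theorem twist_one (f : C(W, ℂ)) : twist h 1 f = f.comp (h.symm : C(W, W)) := by
  ext w
  simp [twist_apply]

/-- The translates under `twist h` of `f * p` over disjoint translates of the support of a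
projection `p` add up to a function of norm at most `‖f‖`. -/
theorem norm_sum_twist_le [CompactSpace W] {p : C(W, ℂ)} (hp : IsStarProjection p) {N : ℕ}
    (horth : ∀ k : ℤ, 1 ≤ k → k ≤ N → p * twist h k p = 0) (f : C(W, ℂ)) (c : ℤ) :
    ‖∑ k ∈ Finset.range (N + 1), twist h (c + k) (f * p)‖ ≤ ‖f‖ := by
  have hval : ∀ w, p w = 0 ∨ p w = 1 := fun w => by
    have := DFunLike.congr_fun hp.isIdempotentElem.eq w
    simp only [ContinuousMap.mul_apply] at this
    by_cases h0 : p w = 0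
    · exact Or.inl h0
    · exact Or.inr (mul_left_cancel₀ h0 (by rw [this, mul_one]))
  have hdis : ∀ i j : ℕ, i < j → j < N + 1 → ∀ w,
      p ((h ^ (-(c + i))) w) = 0 ∨ p ((h ^ (-(c + j))) w) = 0 := by
    intro i j hij hj w
    have := DFunLike.congr_fun (horth (j - i) (by omega) (by omega)) ((h ^ (-(c + i))) w)
    simp only [ContinuousMap.mul_apply, twist_apply, ContinuousMap.zero_apply, mul_eq_zero] at this
    rwa [← Homeomorph.mul_apply, ← zpow_add,
      show -((j : ℤ) - i) + -(c + i) = -(c + j) by ring] at this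
  rw [ContinuousMap.norm_le _ (norm_nonneg f)]
  intro w
  rw [ContinuousMap.sum_apply]
  simp only [twist_apply, ContinuousMap.mul_apply]
  by_cases hall : ∀ k ∈ Finset.range (N + 1), p ((h ^ (-(c + (k : ℤ)))) w) = 0
  · rw [Finset.sum_eq_zero fun k hk => by rw [hall k hk, mul_zero]]
    simp
  · push Not at hall
    obtain ⟨k, hk, hk0⟩ := hall
    rw [Finset.sum_eq_single k]
    · rw [(hval _).resolve_left hk0, mul_one]
      exact f.norm_coe_le_norm _
    · intro j hj hjk
      rcases lt_or_gt_of_ne hjk with hlt | hlt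
      · rw [(hdis j k hlt (Finset.mem_range.1 hk) w).resolve_right hk0, mul_zero]
      · rw [(hdis k j hlt (Finset.mem_range.1 hj) w).resolve_left hk0, mul_zero]
    · exact fun h => absurd hk h

/-- A bounded functional on `C(W)` that is `h`-invariant off a set `Z` is `h`-invariant if `Z` has
clopen neighbourhoods with arbitrarily many disjoint translates. -/
theorem twist_one_invariant_of_towers [CompactSpace W] (φ : C(W, ℂ) →L[ℂ] ℂ) (Z : Set W)
    (hφ : ∀ f g : C(W, ℂ), (∀ z ∈ Z, f z = 0) → (∀ z ∈ Z, g z = 0) →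
      φ (twist h 1 (f * g)) = φ (f * g))
    (hZ : ∀ N : ℕ, ∃ p : C(W, ℂ), IsStarProjection p ∧ (∀ z ∈ Z, p z = 1) ∧
      ∀ k : ℤ, 1 ≤ k → k ≤ N → p * twist h k p = 0) (f : C(W, ℂ)) :
    φ (twist h 1 f) = φ f := by
  have key : ∀ N : ℕ, ‖φ (twist h 1 f) - φ f‖ ≤ (2 * (‖φ‖ * ‖f‖)) / (N + 1 : ℝ) := by
    intro N
    obtain ⟨p, hp, hpZ, horth⟩ := hZ (N + 1)
    have hpp : p * p = p := hp.isIdempotentElem.eq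
    have hz : ∀ k : ℤ, 1 ≤ k → k ≤ N + 1 → ∀ z ∈ Z,
        p ((h ^ k) z) = 0 ∧ p ((h ^ (-k)) z) = 0 := by
      intro k h1 h2 z hz
      constructor
      -- Orthogonality evaluated at `h ^ k z` makes the second factor `p z = 1`; evaluated at `z`,
      -- it makes the first factor `p z = 1`. This gives both signs of the exponent.
      · have := DFunLike.congr_fun (horth k h1 (by exact_mod_cast h2)) ((h ^ k) z)
        simp only [ContinuousMap.mul_apply, twist_apply, ContinuousMap.zero_apply] at this
        rw [← Homeomorph.mul_apply, ← zpow_add, neg_add_cancel, zpow_zero,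
          Homeomorph.one_apply, hpZ z hz, mul_one] at this
        exact this
      · have := DFunLike.congr_fun (horth k h1 (by exact_mod_cast h2)) z
        simpa only [ContinuousMap.mul_apply, twist_apply, ContinuousMap.zero_apply, hpZ z hz,
          one_mul] using this
    -- As `p` is idempotent, the translate is a product of two functions vanishing on `Z`. By `hz`
    -- this applies whenever `0 < |k| ≤ N + 1`; the step from `0` to `1` is the one left uncovered.
    have hstep : ∀ k : ℤ, (∀ z ∈ Z, p ((h ^ (-k)) z) = 0) →
        φ (twist h (1 + k) (f * p)) = φ (twist h k (f * p)) := by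
      intro k hk
      have : twist h k (f * p) = twist h k (f * p) * twist h k p := by
        rw [← map_mul, mul_assoc, hpp]
      rw [← twist_twist, this]
      exact hφ _ _ (fun z hzZ => by rw [twist_apply, ContinuousMap.mul_apply, hk z hzZ, mul_zero])
        hk
    have hback : ∀ k : ℕ, k ≤ N → φ (twist h (-k) (f * p)) = φ (f * p) := by
      intro k
      induction k with
      | zero => intro _; rw [Nat.cast_zero, neg_zero, twist_zero]
      | succ k ih =>
        intro hk
        rw [← ih (by omega), ← hstep (-(k + 1 : ℕ))]
        · congr 3
          push_cast
          ring
        · rw [neg_neg]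
          exact fun z hzZ => (hz _ (by omega) (by omega) z hzZ).1
    have hforw : ∀ k : ℕ, k ≤ N → φ (twist h (1 + k) (f * p)) = φ (twist h 1 (f * p)) := by
      intro k
      induction k with
      | zero => intro _; simp
      | succ k ih =>
        intro hk
        rw [← ih (by omega), hstep]
        · congr 3
          push_cast
          ring
        · exact fun z hzZ => (hz _ (by omega) (by omega) z hzZ).2
    have hN : (0 : ℝ) < N + 1 := by positivity
    have hbound : ∀ (c : ℤ) (x : ℂ),
        (∀ k ∈ Finset.range (N + 1), φ (twist h (c + k) (f * p)) = x) →
          ‖x‖ ≤ ‖φ‖ * ‖f‖ / (N + 1 : ℝ) := by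
      intro c x hx
      have h1 := norm_sum_twist_le h hp (N := N)
        (fun k h1 h2 => horth k h1 (by push_cast; omega)) f c
      have h2 := φ.le_opNorm_of_le h1
      rw [map_sum, Finset.sum_congr rfl hx, Finset.sum_const, Finset.card_range, nsmul_eq_mul,
        norm_mul, Complex.norm_natCast] at h2
      rw [le_div_iff₀ hN, mul_comm]
      exact_mod_cast h2
    have hg : ‖φ (f * p)‖ ≤ ‖φ‖ * ‖f‖ / (N + 1 : ℝ) := by
      -- The two windows of exponents are `-N, …, 0` here and `1, …, N + 1` below; neither contains
      -- the step from `0` to `1`.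
      refine hbound (-N) _ fun k hk => ?_
      rw [Finset.mem_range] at hk
      rw [← hback (N - k) (by omega)]
      congr 3
      omega
    have hg1 : ‖φ (twist h 1 (f * p))‖ ≤ ‖φ‖ * ‖f‖ / (N + 1 : ℝ) :=
      hbound 1 _ fun k hk => hforw k (by rw [Finset.mem_range] at hk; omega)
    have hoff : φ (twist h 1 (f * (1 - p))) = φ (f * (1 - p)) := by
      have : f * (1 - p) = f * (1 - p) * (1 - p) := by
        linear_combination -(f : C(W, ℂ)) * hpp
      rw [this]
      exact hφ _ _ (fun z hzZ => by simp [hpZ z hzZ]) (fun z hzZ => by simp [hpZ z hzZ])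
    have hsplit : f = f * p + f * (1 - p) := by ring
    have : φ (twist h 1 f) - φ f = φ (twist h 1 (f * p)) - φ (f * p) := by
      conv_lhs => rw [hsplit]
      rw [map_add, map_add, map_add, hoff]
      ring
    rw [this]
    calc _ ≤ _ := norm_sub_le _ _
      _ ≤ _ := add_le_add hg1 hg
      _ = _ := by ring
  have hlim : Filter.Tendsto (fun N : ℕ => (2 * (‖φ‖ * ‖f‖)) / (N + 1 : ℝ)) Filter.atTop
      (nhds 0) :=
    tendsto_const_nhds.div_atTop
      (Filter.tendsto_atTop_add_const_right _ _ tendsto_natCast_atTop_atTop)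
  exact sub_eq_zero.1 (norm_le_zero_iff.1 (ge_of_tendsto' hlim key))

/-- A trace vanishes on the elements that implement a nonzero power `h ^ n` on the image of `C(W)`
if `h ^ n` moves every point off a clopen neighbourhood. -/
theorem TracialState.apply_eq_zero_of_twist [CompactSpace W] {D : Type*} [CStarAlgebra D]
    (τ : TracialState D) (ρ : C(W, ℂ) →⋆ₐ[ℂ] D) {n : ℤ}
    (hfree : ∀ w, ∃ p : C(W, ℂ), IsStarProjection p ∧ p w = 1 ∧ p * twist h n p = 0)
    (b : D) (hb : ∀ g, b * ρ g = ρ (twist h n g) * b) : τ b = 0 := by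
  have key : ∃ q : C(W, ℂ), (∀ w ∈ Set.univ, q w = 1) ∧ ∀ g, τ (ρ (g * q) * b) = 0 := by
    -- Quantifying over all `g` lets the union step absorb the factor `1 - q` into `g`.
    refine (isCompact_univ : IsCompact (Set.univ : Set W)).induction_on
      (p := fun s => ∃ q : C(W, ℂ), (∀ w ∈ s, q w = 1) ∧ ∀ g, τ (ρ (g * q) * b) = 0) ?_ ?_ ?_ ?_
    · exact ⟨0, by simp, by simp⟩
    · rintro s t hst ⟨q, hq, hq0⟩
      exact ⟨q, fun w hw => hq w (hst hw), hq0⟩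
    · rintro s t ⟨q, hq, hq0⟩ ⟨r, hr, hr0⟩
      refine ⟨q + r - q * r, ?_, fun g => ?_⟩
      · rintro w (hw | hw)
        · simp [hq w hw]
        · simp [hr w hw]
      · have : g * (q + r - q * r) = g * q + (g * (1 - q)) * r := by ring
        rw [this, map_add, add_mul, map_add, hq0, hr0, add_zero]
    · intro w _
      obtain ⟨p, hp, hpw, hpn⟩ := hfree w
      have hpp : p * p = p := hp.isIdempotentElem.eq
      refine ⟨{v | p v ≠ 0}, mem_nhdsWithin_of_mem_nhds
        ((isOpen_ne_fun p.continuous continuous_const).mem_nhds (by simp [hpw])), p,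
        fun v hv => ?_, fun g => ?_⟩
      · have := DFunLike.congr_fun hpp v
        simp only [ContinuousMap.mul_apply] at this
        exact mul_left_cancel₀ hv (by rw [this, mul_one])
      -- One copy of `p` is moved cyclically to the right of `b` and back across it, where it
      -- becomes `twist h n p` and annihilates the other copy.
      · have : g * p = p * (g * p) := by linear_combination (-g) * hpp
        rw [this, map_mul ρ, mul_assoc, τ.map_mul_comm, mul_assoc, hb, ← mul_assoc, ← map_mul,
          mul_assoc, hpn, mul_zero, map_zero, zero_mul, map_zero]
  obtain ⟨q, hq, hq0⟩ := key
  have : q = 1 := by ext w; simpa using hq w trivial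
  simpa [this] using hq0 1

end Twist

/-! ### Algebra of the monomials `f U ^ n` and induction on generated algebras. -/

section Generated

variable {W : Type*} [TopologicalSpace W] {h : W ≃ₜ W} {C : Type*} [CStarAlgebra C]
  {ρ : C(W, ℂ) →⋆ₐ[ℂ] C} {U : unitary C}

theorem unitary_zpow_mul_of_covariant
    (hcov : ∀ f, (U : C) * ρ f * star (U : C) = ρ (f.comp (h.symm : C(W, W)))) (n : ℤ)
    (f : C(W, ℂ)) : ((U ^ n : unitary C) : C) * ρ f = ρ (twist h n f) * (U ^ n : unitary C) := by
  have h1 : ∀ f, (U : C) * ρ f = ρ (twist h 1 f) * U := fun f => by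
    rw [twist_one, ← hcov, mul_assoc, Unitary.coe_star_mul_self, mul_one]
  have h2 : ∀ f, ((U⁻¹ : unitary C) : C) * ρ f = ρ (twist h (-1) f) * (U⁻¹ : unitary C) := by
    intro f
    have h3 := h1 (twist h (-1) f)
    rw [twist_twist, add_neg_cancel, twist_zero] at h3
    have h4 : ((U⁻¹ : unitary C) : C) * U = 1 := Unitary.coe_star_mul_self U
    have h5 : (U : C) * (U⁻¹ : unitary C) = 1 := Unitary.coe_mul_star_self U
    calc _ = ((U⁻¹ : unitary C) : C) * (ρ f * U) * (U⁻¹ : unitary C) := by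
          rw [mul_assoc, mul_assoc, h5, mul_one]
      _ = _ := by rw [← h3, ← mul_assoc, h4, one_mul]
  induction n generalizing f with
  | zero => simp [twist_zero]
  | succ n ih =>
    rw [zpow_add_one, Submonoid.coe_mul, mul_assoc, h1, ← mul_assoc, ih, twist_twist, mul_assoc]
  | pred n ih =>
    rw [zpow_sub_one, Submonoid.coe_mul, mul_assoc, h2, ← mul_assoc, ih, twist_twist, mul_assoc,
      sub_eq_add_neg]

theorem mul_unitary_zpow_mul
    (hcov : ∀ f, (U : C) * ρ f * star (U : C) = ρ (f.comp (h.symm : C(W, W)))) (f g : C(W, ℂ))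
    (m n : ℤ) : ρ f * (U ^ m : unitary C) * (ρ g * (U ^ n : unitary C)) =
      ρ (f * twist h m g) * (U ^ (m + n) : unitary C) := by
  rw [mul_assoc, ← mul_assoc _ (ρ g), unitary_zpow_mul_of_covariant hcov, zpow_add,
    Submonoid.coe_mul, map_mul]
  simp only [mul_assoc]

theorem star_mul_unitary_zpow
    (hcov : ∀ f, (U : C) * ρ f * star (U : C) = ρ (f.comp (h.symm : C(W, W)))) (f : C(W, ℂ))
    (m : ℤ) : star (ρ f * (U ^ m : unitary C)) =
      ρ (twist h (-m) (star f)) * (U ^ (-m) : unitary C) := by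
  rw [star_mul, ← Unitary.coe_star, Unitary.star_eq_inv, ← zpow_neg, ← map_star,
    unitary_zpow_mul_of_covariant hcov]

/-- A closed additive property holds on the C⋆-algebra generated by elements of the form
`f * U ^ n` as soon as it holds for the elements of this form. -/
theorem cstarGenerated_induction
    (hcov : ∀ f, (U : C) * ρ f * star (U : C) = ρ (f.comp (h.symm : C(W, W)))) {s : Set C}
    (hs : ∀ a ∈ s, ∃ (f : C(W, ℂ)) (n : ℤ), a = ρ f * (U ^ n : unitary C))
    {p : cstarGenerated s → Prop} (hclosed : IsClosed {b | p b})
    (hadd : ∀ a b, p a → p b → p (a + b))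
    (hmono : ∀ (b : cstarGenerated s) (f : C(W, ℂ)) (n : ℤ),
      (b : C) = ρ f * (U ^ n : unitary C) → p b) (b : cstarGenerated s) : p b := by
  have hcl : ∀ a ∈ Submonoid.closure (s ∪ star s),
      ∃ (f : C(W, ℂ)) (n : ℤ), a = ρ f * (U ^ n : unitary C) := by
    intro a ha
    induction ha using Submonoid.closure_induction with
    | mem a ha =>
      rcases ha with ha | ha
      · exact hs a ha
      · obtain ⟨f, n, hf⟩ := hs _ ha
        exact ⟨_, _, by rw [← star_star a, hf, star_mul_unitary_zpow hcov]⟩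
    | one => exact ⟨1, 0, by simp⟩
    | mul a b _ _ iha ihb =>
      obtain ⟨f, m, rfl⟩ := iha
      obtain ⟨g, n, rfl⟩ := ihb
      exact ⟨_, _, mul_unitary_zpow_mul hcov f g m n⟩
  have hle : StarAlgebra.adjoin ℂ s ≤ cstarGenerated s := StarSubalgebra.le_topologicalClosure _
  have hadj : ∀ a (ha : a ∈ StarAlgebra.adjoin ℂ s), p ⟨a, hle ha⟩ := by
    intro a ha
    have ha' : a ∈ Submodule.span ℂ (Submonoid.closure (s ∪ star s) : Set C) := by
      rw [← StarAlgebra.adjoin_eq_span]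
      exact ha
    -- `p` lives on the subtype, so membership is proved along with it during the induction.
    suffices ∃ h, p ⟨a, h⟩ from this.2
    clear ha
    induction ha' using Submodule.closure_induction with
    | zero => exact ⟨zero_mem _, hmono _ 0 0 (by simp)⟩
    | add a b _ _ iha ihb =>
      obtain ⟨ha, hpa⟩ := iha
      obtain ⟨hb, hpb⟩ := ihb
      exact ⟨add_mem ha hb, hadd _ _ hpa hpb⟩
    -- Scalars are absorbed into the coefficient `f`, so additivity of `p` is enough.
    | smul_mem r a ha =>
      obtain ⟨f, n, hf⟩ := hcl a ha
      have hmem : a ∈ cstarGenerated s := hle <| by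
        change a ∈ Subalgebra.toSubmodule (StarAlgebra.adjoin ℂ s).toSubalgebra
        rw [StarAlgebra.adjoin_eq_span]
        exact Submodule.subset_span ha
      exact ⟨SMulMemClass.smul_mem r hmem,
        hmono _ (r • f) n (by simp only [hf, map_smul, smul_mul_assoc])⟩
  have hdense : Dense {b : cstarGenerated s | (b : C) ∈ StarAlgebra.adjoin ℂ s} := by
    rw [Subtype.dense_iff]
    intro a ha
    refine closure_mono ?_ ha
    intro c hc
    exact ⟨⟨c, hle hc⟩, hc, rfl⟩
  exact hclosed.closure_subset_iff.2 (fun b hb => hadj b hb) (hdense b)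

end Generated

/-! ### Traces on generated algebras are determined on `C(W)`. -/

section Generated

variable {W : Type*} [TopologicalSpace W] [CompactSpace W] {h : W ≃ₜ W} {C : Type*}
  [CStarAlgebra C] {ρ : C(W, ℂ) →⋆ₐ[ℂ] C} {U : unitary C}

/-- The corestriction of `ρ` to a generated C⋆-subalgebra whose generators contain its range. -/
def cstarGeneratedFn (ρ : C(W, ℂ) →⋆ₐ[ℂ] C) {s : Set C} (hρ : ∀ f, ρ f ∈ s) :
    C(W, ℂ) →⋆ₐ[ℂ] cstarGenerated s :=
  ρ.codRestrict (cstarGenerated s) fun f => subset_cstarGenerated s (hρ f)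

/-- If `h` acts freely through clopen sets, a trace on a generated C⋆-algebra between `C(W)` and the
crossed product vanishes on the elements `f * U ^ n` with `n ≠ 0`. -/
theorem TracialState.apply_eq_zero_of_coe_eq
    (hcov : ∀ f, (U : C) * ρ f * star (U : C) = ρ (f.comp (h.symm : C(W, W))))
    (hfree : ∀ n : ℤ, n ≠ 0 → ∀ w, ∃ p : C(W, ℂ),
      IsStarProjection p ∧ p w = 1 ∧ p * twist h n p = 0)
    {s : Set C} (hρ : ∀ f, ρ f ∈ s) (τ : TracialState (cstarGenerated s)) {b : cstarGenerated s}
    {f : C(W, ℂ)} {n : ℤ} (hn : n ≠ 0) (hb : (b : C) = ρ f * (U ^ n : unitary C)) : τ b = 0 := by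
  refine τ.apply_eq_zero_of_twist h (cstarGeneratedFn ρ hρ) (hfree n hn) b fun g => ?_
  apply Subtype.ext
  change (b : C) * ρ g = ρ (twist h n g) * b
  rw [hb, mul_assoc, unitary_zpow_mul_of_covariant hcov, ← mul_assoc, ← mul_assoc, ← map_mul,
    ← map_mul, mul_comm]

/-- If `h` acts freely through clopen sets, a trace on a generated C⋆-algebra between `C(W)` and the
crossed product is determined by its values on `C(W)`. -/
theorem TracialState.ext_of_fn
    (hcov : ∀ f, (U : C) * ρ f * star (U : C) = ρ (f.comp (h.symm : C(W, W))))
    (hfree : ∀ n : ℤ, n ≠ 0 → ∀ w, ∃ p : C(W, ℂ),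
      IsStarProjection p ∧ p w = 1 ∧ p * twist h n p = 0)
    {s : Set C} (hρ : ∀ f, ρ f ∈ s)
    (hs : ∀ a ∈ s, ∃ (f : C(W, ℂ)) (n : ℤ), a = ρ f * (U ^ n : unitary C))
    {τ σ : TracialState (cstarGenerated s)}
    (heq : ∀ f, τ (cstarGeneratedFn ρ hρ f) = σ (cstarGeneratedFn ρ hρ f)) : τ = σ := by
  apply TracialState.ext
  apply ContinuousLinearMap.ext
  refine cstarGenerated_induction hcov hs ?_ ?_ ?_
  · exact isClosed_eq τ.functional.continuous σ.functional.continuous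
  · intro a b ha hb
    rw [map_add, map_add, ha, hb]
  · intro b f n hb
    by_cases hn : n = 0
    · have : b = cstarGeneratedFn ρ hρ f := by
        apply Subtype.ext
        rw [hb, hn]
        simp [cstarGeneratedFn]
      rw [this]
      exact heq f
    · rw [τ.apply_eq_zero_of_coe_eq hcov hfree hρ hn hb,
        σ.apply_eq_zero_of_coe_eq hcov hfree hρ hn hb]

end Generated

/-! ### Weighted shifts on `ℓ²`, covering multiplication operators and the bilateral shift. -/

section WeightedShift

variable {I : Type*}

theorem memℓp_weightedShift {c : I → ℂ} {K : ℝ} (hc : ∀ i, ‖c i‖ ≤ K) (e : I ≃ I)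
    (x : lp (fun _ : I => ℂ) 2) : Memℓp (fun i => c i * x (e i)) 2 := by
  have h2 : (0 : ℝ) < (2 : ℝ≥0∞).toReal := by simp
  rw [memℓp_gen_iff h2]
  have hx := (e.summable_iff).2 ((memℓp_gen_iff h2).1 (lp.memℓp x))
  refine Summable.of_nonneg_of_le (fun i => by positivity) (fun i => ?_)
    (hx.mul_left (K ^ (2 : ℝ≥0∞).toReal))
  have hK : 0 ≤ K := (norm_nonneg _).trans (hc i)
  rw [norm_mul, Function.comp, ← Real.mul_rpow hK (norm_nonneg _)]
  gcongr
  exact hc i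

/-- The operator `x ↦ (c i * x (e i))ᵢ` on `ℓ²(I)`, for bounded weights `c`. -/
def weightedShift {c : I → ℂ} {K : ℝ} (hc : ∀ i, ‖c i‖ ≤ K) (e : I ≃ I) :
    lp (fun _ : I => ℂ) 2 →L[ℂ] lp (fun _ : I => ℂ) 2 :=
  LinearMap.mkContinuous
    { toFun := fun x => ⟨fun i => c i * x (e i), memℓp_weightedShift hc e x⟩
      map_add' := fun x y => by ext i; simp [mul_add]; rfl
      -- When `I` is empty, `K` may be negative, hence the bound `|K|`.
      map_smul' := fun r x => by ext i; simp [mul_left_comm] } |K| fun x => by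
    have h2 : (0 : ℝ) < (2 : ℝ≥0∞).toReal := by simp
    refine lp.norm_le_of_tsum_le h2 (by positivity) ?_
    rw [Real.mul_rpow (abs_nonneg K) (norm_nonneg _), lp.norm_rpow_eq_tsum h2, ← tsum_mul_left,
      ← e.tsum_eq fun i => |K| ^ (2 : ℝ≥0∞).toReal * ‖x i‖ ^ (2 : ℝ≥0∞).toReal]
    have hx := ((e.summable_iff).2 ((memℓp_gen_iff h2).1 (lp.memℓp x))).mul_left
      (|K| ^ (2 : ℝ≥0∞).toReal)
    refine Summable.tsum_le_tsum (fun i => ?_)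
      ((memℓp_gen_iff h2).1 (memℓp_weightedShift hc e x)) hx
    rw [← Real.mul_rpow (abs_nonneg K) (norm_nonneg _)]
    refine Real.rpow_le_rpow (norm_nonneg _) ?_ (by simp)
    change ‖c i * x (e i)‖ ≤ _
    rw [norm_mul]
    gcongr
    exact (hc i).trans (le_abs_self K)

@[simp]
theorem weightedShift_apply {c : I → ℂ} {K : ℝ} (hc : ∀ i, ‖c i‖ ≤ K) (e : I ≃ I)
    (x : lp (fun _ : I => ℂ) 2) (i : I) : weightedShift hc e x i = c i * x (e i) := rfl

/-- Substituting `e i` for `i` in the sum defining the inner product moves the shift and the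
conjugated weight to the other side. -/
theorem star_weightedShift {c d : I → ℂ} {K L : ℝ} (hc : ∀ i, ‖c i‖ ≤ K) (hd : ∀ i, ‖d i‖ ≤ L)
    (e : I ≃ I) (hcd : ∀ i, star (c i) = d (e i)) :
    star (weightedShift hc e) = weightedShift hd e.symm := by
  rw [ContinuousLinearMap.star_eq_adjoint]
  symm
  rw [ContinuousLinearMap.eq_adjoint_iff]
  intro x y
  rw [lp.inner_eq_tsum, lp.inner_eq_tsum, ← e.tsum_eq]
  congr 1
  ext i
  have := hcd i
  simp only [weightedShift_apply, Equiv.symm_apply_apply, RCLike.inner_apply, ← hcd i]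
  simp
  ring

end WeightedShift

/-! ### The regular representation along an orbit. -/

section RegularRepresentation

variable {W : Type u} [TopologicalSpace W] [CompactSpace W] (h : W ≃ₜ W) (w : W)

/-- The Hilbert space `ℓ²(ℤ)`, in the universe `u`. -/
abbrev EllTwoInt : Type u := lp (fun _ : ULift.{u} ℤ => ℂ) 2

instance : Nontrivial EllTwoInt.{u} :=
  ⟨⟨lp.single 2 0 1, 0, fun h0 => by
    have := congrArg (fun x : EllTwoInt.{u} => x 0) h0
    simp at this⟩⟩

/-- The representation of `C(W)` on `ℓ²(ℤ)` by multiplication along the orbit of `w`. -/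
def orbitRep : C(W, ℂ) →⋆ₐ[ℂ] (EllTwoInt.{u} →L[ℂ] EllTwoInt.{u}) where
  toFun f := weightedShift (c := fun k : ULift.{u} ℤ => f ((h ^ k.down) w))
    (fun _ => f.norm_coe_le_norm _) (Equiv.refl _)
  map_one' := by ext; simp
  map_mul' f g := by ext; simp [mul_assoc]
  map_zero' := by ext; simp
  map_add' f g := by ext; simp [add_mul]
  commutes' r := by ext; simp [Algebra.algebraMap_eq_smul_one]
  map_star' f := by
    have hd : ∀ k : ULift.{u} ℤ, ‖star (f ((h ^ k.down) w))‖ ≤ ‖f‖ := fun k => by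
      rw [norm_star]
      exact f.norm_coe_le_norm _
    exact (star_weightedShift (c := fun k : ULift.{u} ℤ => f ((h ^ k.down) w))
      (fun _ => f.norm_coe_le_norm _) hd (Equiv.refl _) (fun i => rfl)).symm

/-- The bilateral shift by `n` on `ℓ²(ℤ)`. -/
def bilateralShift (n : ℤ) : EllTwoInt.{u} →L[ℂ] EllTwoInt.{u} :=
  weightedShift (c := fun _ => 1) (K := 1) (by simp)
    (Equiv.ulift.trans ((Equiv.subRight n).trans Equiv.ulift.symm))

@[simp]
theorem bilateralShift_apply (n : ℤ) (x : EllTwoInt.{u}) (k : ULift.{u} ℤ) :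
    bilateralShift n x k = x ⟨k.down - n⟩ :=
  one_mul _

theorem bilateralShift_mul (m n : ℤ) :
    (bilateralShift m : EllTwoInt.{u} →L[ℂ] _) * bilateralShift n = bilateralShift (m + n) := by
  ext x k
  simp [sub_sub]

theorem star_bilateralShift (n : ℤ) :
    star (bilateralShift n : EllTwoInt.{u} →L[ℂ] _) = bilateralShift (-n) := by
  rw [bilateralShift, star_weightedShift _ (d := fun _ => 1) (L := 1) (by simp) _ (by simp)]
  ext x k
  simp

theorem bilateralShift_zero : (bilateralShift 0 : EllTwoInt.{u} →L[ℂ] _) = 1 := by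
  ext x k
  simp

/-- The bilateral shift as a unitary operator. -/
def bilateralShiftUnitary : unitary (EllTwoInt.{u} →L[ℂ] EllTwoInt.{u}) :=
  ⟨bilateralShift 1, by
    rw [Unitary.mem_iff, star_bilateralShift, bilateralShift_mul, bilateralShift_mul]
    simp [bilateralShift_zero]⟩

theorem coe_bilateralShiftUnitary_zpow (n : ℤ) :
    ((bilateralShiftUnitary ^ n : unitary (EllTwoInt.{u} →L[ℂ] EllTwoInt.{u})) :
      EllTwoInt.{u} →L[ℂ] EllTwoInt.{u}) = bilateralShift n := by
  have hinv : ((bilateralShiftUnitary⁻¹ : unitary (EllTwoInt.{u} →L[ℂ] EllTwoInt.{u})) :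
      EllTwoInt.{u} →L[ℂ] EllTwoInt.{u}) = bilateralShift (-1) := star_bilateralShift 1
  induction n with
  | zero => simp [bilateralShift_zero]
  | succ n ih =>
    rw [zpow_add_one, Submonoid.coe_mul, ih]
    exact bilateralShift_mul _ _
  | pred n ih =>
    rw [zpow_sub_one, Submonoid.coe_mul, ih, hinv, bilateralShift_mul, sub_eq_add_neg]

/-- The covariant pair on `ℓ²(ℤ)` induced by the evaluation at `w`. -/
def orbitPair : CovariantPair h where
  B := EllTwoInt.{u} →L[ℂ] EllTwoInt.{u}
  π := orbitRep h w
  U := bilateralShiftUnitary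
  covariant f := by
    change bilateralShift 1 * orbitRep h w f * star (bilateralShift 1) = _
    rw [star_bilateralShift]
    ext x k
    -- Conjugation by the shift puts the weight of index `k - 1` at `k`.
    change 1 * (f ((h ^ (k.down - 1)) w) * bilateralShift (-1) x ⟨k.down - 1⟩) =
      f (h.symm ((h ^ k.down) w)) * x k
    rw [one_mul, bilateralShift_apply, sub_eq_neg_add, zpow_add, Homeomorph.mul_apply, zpow_neg_one]
    simp

end RegularRepresentation

/-! ### The crossed product, its conditional expectation, and induced traces. -/

section CrossedProduct

variable {W : Type u} [TopologicalSpace W] (h : W ≃ₜ W)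

/-- `universalUnitary` as an element of the unitary group. -/
def universalU : unitary (CovariantProduct h) :=
  ⟨universalUnitary h, by
    rw [Unitary.mem_iff]
    constructor
    · ext p
      exact Unitary.coe_star_mul_self p.U
    · ext p
      exact Unitary.coe_mul_star_self p.U⟩

theorem universalU_zpow_apply (p : CovariantPair h) (n : ℤ) :
    ((universalU h ^ n : unitary (CovariantProduct h)) : CovariantProduct h) p =
      (p.U ^ n : unitary p.B) := by
  induction n with
  | zero => rfl
  | succ n ih =>
    rw [zpow_add_one, zpow_add_one, Submonoid.coe_mul, Submonoid.coe_mul, ← ih]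
    rfl
  | pred n ih =>
    rw [zpow_sub_one, zpow_sub_one, Submonoid.coe_mul, Submonoid.coe_mul, ← ih]
    rfl

variable [CompactSpace W]

/-- `universalFn` as a ⋆-homomorphism. -/
def universalFnHom : C(W, ℂ) →⋆ₐ[ℂ] CovariantProduct h where
  toFun := universalFn h
  map_one' := by ext p; exact map_one p.π
  map_mul' f g := by ext p; exact map_mul p.π f g
  map_zero' := by ext p; exact map_zero p.π
  map_add' f g := by ext p; exact map_add p.π f g
  commutes' r := by ext p; exact AlgHomClass.commutes p.π r
  map_star' f := by ext p; exact map_star p.π f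

theorem universal_covariant (f : C(W, ℂ)) :
    (universalU h : CovariantProduct h) * universalFnHom h f *
      star (universalU h : CovariantProduct h) =
      universalFnHom h (f.comp (h.symm : C(W, W))) := by
  ext p
  exact p.covariant f

/-- `CrossedProduct.fn` as a ⋆-homomorphism. -/
def CrossedProduct.fnHom : C(W, ℂ) →⋆ₐ[ℂ] CrossedProduct h :=
  cstarGeneratedFn (universalFnHom h) fun f => Or.inl ⟨f, rfl⟩

/-- `CrossedProduct.u` as an element of the unitary group. -/
def CrossedProduct.unitaryU : unitary (CrossedProduct h) :=
  ⟨CrossedProduct.u h, by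
    rw [Unitary.mem_iff]
    exact ⟨Subtype.ext (Unitary.coe_star_mul_self (universalU h)),
      Subtype.ext (Unitary.coe_mul_star_self (universalU h))⟩⟩

theorem CrossedProduct.covariant (f : C(W, ℂ)) :
    (CrossedProduct.unitaryU h : CrossedProduct h) * CrossedProduct.fnHom h f *
      star (CrossedProduct.unitaryU h : CrossedProduct h) =
      CrossedProduct.fnHom h (f.comp (h.symm : C(W, W))) :=
  Subtype.ext (universal_covariant h f)

theorem crossedProductGenerators_form :
    ∀ a ∈ Set.range (universalFn h) ∪ {universalUnitary h}, ∃ (f : C(W, ℂ)) (n : ℤ),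
      a = universalFnHom h f * (universalU h ^ n : unitary (CovariantProduct h)) := by
  rintro a (⟨f, rfl⟩ | rfl)
  · exact ⟨f, 0, by rw [zpow_zero, Submonoid.coe_one, mul_one]; rfl⟩
  · exact ⟨1, 1, by rw [map_one, one_mul, zpow_one]; rfl⟩

/-- A closed additive property holds on the crossed product as soon as it holds for the elements
`f * u ^ n`. -/
theorem CrossedProduct.induction {p : CrossedProduct h → Prop} (hclosed : IsClosed {a | p a})
    (hadd : ∀ a b, p a → p b → p (a + b))
    (hmono : ∀ (a : CrossedProduct h) (f : C(W, ℂ)) (n : ℤ),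
      a.1 = universalFnHom h f * (universalU h ^ n : unitary (CovariantProduct h)) → p a)
    (a : CrossedProduct h) : p a :=
  cstarGenerated_induction (universal_covariant h) (crossedProductGenerators_form h) hclosed hadd
    hmono a

theorem orbitBreakingGenerators_form (Z : Set W) :
    ∀ a ∈ orbitBreakingGenerators h Z, ∃ (f : C(W, ℂ)) (n : ℤ),
      a = CrossedProduct.fnHom h f *
        (CrossedProduct.unitaryU h ^ n : unitary (CrossedProduct h)) := by
  rintro a (⟨f, rfl⟩ | ⟨f, -, rfl⟩)
  · exact ⟨f, 0, by rw [zpow_zero, Submonoid.coe_one, mul_one]; rfl⟩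
  · refine ⟨twist h 1 f, 1, ?_⟩
    rw [← unitary_zpow_mul_of_covariant (CrossedProduct.covariant h), zpow_one]
    rfl

/-- `OrbitBreaking.fn` as a ⋆-homomorphism. -/
def OrbitBreaking.fnHom (Z : Set W) : C(W, ℂ) →⋆ₐ[ℂ] OrbitBreaking h Z :=
  cstarGeneratedFn (CrossedProduct.fnHom h) fun f => Or.inl ⟨f, rfl⟩

/-- `OrbitBreaking.fn` as a continuous linear map. -/
def OrbitBreaking.fnCLM (Z : Set W) : C(W, ℂ) →L[ℂ] OrbitBreaking h Z :=
  (OrbitBreaking.fnHom h Z).toAlgHom.toLinearMap.mkContinuous 1 fun f => by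
    rw [one_mul]
    exact NonUnitalStarAlgHom.norm_apply_le (OrbitBreaking.fnHom h Z) f

/-- A trace on the orbit-breaking subalgebra is invariant on products of functions vanishing
on `Z`. -/
theorem OrbitBreaking.trace_twist_one_of_vanishing (Z : Set W)
    (τ : TracialState (OrbitBreaking h Z)) (f g : C(W, ℂ)) (hf : ∀ z ∈ Z, f z = 0) (hg : ∀ z ∈ Z, g z = 0) :
    τ (OrbitBreaking.fnHom h Z (twist h 1 (f * g))) = τ (OrbitBreaking.fnHom h Z (f * g)) := by
  have hmem : ∀ f : C(W, ℂ), (∀ z ∈ Z, f z = 0) → CrossedProduct.u h * CrossedProduct.fn h f ∈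
      cstarGenerated (orbitBreakingGenerators h Z) := fun f hf =>
    subset_cstarGenerated _ (Or.inr ⟨f, hf, rfl⟩)
  -- With `a = u f` and `b = u (star g)`, `a b⋆ = u f g u⋆` while the two unitaries cancel in `b⋆
  -- a`.
  let a : OrbitBreaking h Z := ⟨_, hmem f hf⟩
  let b : OrbitBreaking h Z := ⟨_, hmem (star g) (fun z hz => by simp [hg z hz])⟩
  have h1 : a * star b = OrbitBreaking.fnHom h Z (twist h 1 (f * g)) := by
    apply Subtype.ext
    change (CrossedProduct.unitaryU h : CrossedProduct h) * CrossedProduct.fnHom h f *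
      star ((CrossedProduct.unitaryU h : CrossedProduct h) * CrossedProduct.fnHom h (star g)) =
      CrossedProduct.fnHom h (twist h 1 (f * g))
    rw [star_mul, ← map_star, star_star, mul_assoc, ← mul_assoc _ _ (star _), ← map_mul,
      ← mul_assoc, CrossedProduct.covariant, twist_one]
  have h2 : star b * a = OrbitBreaking.fnHom h Z (f * g) := by
    apply Subtype.ext
    change star ((CrossedProduct.unitaryU h : CrossedProduct h) * CrossedProduct.fnHom h (star g)) *
      ((CrossedProduct.unitaryU h : CrossedProduct h) * CrossedProduct.fnHom h f) =
      CrossedProduct.fnHom h (f * g)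
    rw [star_mul, ← map_star, star_star, mul_assoc, ← mul_assoc (star _),
      Unitary.coe_star_mul_self, one_mul, ← map_mul, mul_comm]
  rw [← h1, ← h2, τ.map_mul_comm]

/-- The vector state at the origin of the orbit representation at `w`. -/
def orbitCoefficient (a : CrossedProduct h) (w : W) : ℂ :=
  inner ℂ (lp.single 2 0 1 : EllTwoInt.{u})
    ((show EllTwoInt.{u} →L[ℂ] EllTwoInt.{u} from a.1 (orbitPair h w)) (lp.single 2 0 1))

theorem orbitCoefficient_add (a b : CrossedProduct h) (w : W) :
    orbitCoefficient h (a + b) w = orbitCoefficient h a w + orbitCoefficient h b w :=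
  inner_add_right _ _ _

theorem orbitCoefficient_smul (r : ℂ) (a : CrossedProduct h) (w : W) :
    orbitCoefficient h (r • a) w = r * orbitCoefficient h a w :=
  inner_smul_right _ _ _

theorem norm_orbitCoefficient_le (a : CrossedProduct h) (w : W) :
    ‖orbitCoefficient h a w‖ ≤ ‖a‖ := by
  have hδ : ‖(lp.single 2 0 1 : EllTwoInt.{u})‖ = 1 := by
    rw [lp.norm_single (by simp), norm_one]
  refine (norm_inner_le_norm _ _).trans ?_
  rw [hδ, one_mul]
  refine (ContinuousLinearMap.le_opNorm _ _).trans ?_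
  rw [hδ, mul_one]
  exact lp.norm_apply_le_norm (by simp) a.1 (orbitPair h w)

theorem orbitCoefficient_star_mul_self (a : CrossedProduct h) (w : W) :
    0 ≤ orbitCoefficient h (star a * a) w := by
  let T : EllTwoInt.{u} →L[ℂ] EllTwoInt.{u} := a.1 (orbitPair h w)
  have : orbitCoefficient h (star a * a) w =
      inner ℂ (lp.single 2 0 1 : EllTwoInt.{u}) ((star T * T) (lp.single 2 0 1)) := rfl
  rw [this, mul_apply_eq_comp, ContinuousLinearMap.star_eq_adjoint,
    ContinuousLinearMap.adjoint_inner_right, inner_self_eq_norm_sq_to_K]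
  rw [← RCLike.ofReal_pow]
  exact Complex.zero_le_real.2 (sq_nonneg _)

theorem orbitCoefficient_sub (a b : CrossedProduct h) (w : W) :
    orbitCoefficient h (a - b) w = orbitCoefficient h a w - orbitCoefficient h b w :=
  inner_sub_right _ _ _

/-- The coefficients are contractive in `a` uniformly in `w`, and uniform limits of continuous
functions are continuous. This reduces continuity of `E(a)` to monomials. -/
theorem isClosed_continuous_orbitCoefficient :
    IsClosed {a : CrossedProduct h | Continuous (orbitCoefficient h a)} := by
  refine isClosed_of_closure_subset fun a ha => ?_
  refine continuous_of_uniform_approx_of_continuous fun V hV => ?_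
  obtain ⟨ε, hε, hεV⟩ := Metric.mem_uniformity_dist.1 hV
  obtain ⟨b, hb, hab⟩ := Metric.mem_closure_iff.1 ha ε hε
  refine ⟨orbitCoefficient h b, hb, fun w => hεV (lt_of_le_of_lt ?_ hab)⟩
  rw [dist_eq_norm, dist_eq_norm, ← orbitCoefficient_sub]
  exact norm_orbitCoefficient_le h _ w

/-- The shift by `n` sends the basis vector at the origin to the one at `n`, orthogonal to it unless
`n = 0`; multiplication by `f` has weight `f w` at the origin. -/
theorem orbitCoefficient_monomial (f : C(W, ℂ)) (n : ℤ) (a : CrossedProduct h)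
    (ha : a.1 = universalFnHom h f * (universalU h ^ n : unitary (CovariantProduct h))) (w : W) :
    orbitCoefficient h a w = if n = 0 then f w else 0 := by
  have hpow := universalU_zpow_apply h (orbitPair h w) n
  let T : EllTwoInt.{u} →L[ℂ] EllTwoInt.{u} := a.1 (orbitPair h w)
  have hT : T = orbitRep h w f * bilateralShift n := by
    simp only [T, ha]
    change orbitRep h w f * _ = _
    rw [hpow]
    exact congrArg _ (coe_bilateralShiftUnitary_zpow n)
  have hδ : (bilateralShift n (lp.single 2 0 1 : EllTwoInt.{u})) 0 = if n = 0 then 1 else 0 := by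
    rw [bilateralShift_apply]
    split_ifs with hn
    · subst hn
      exact lp.single_apply_self ..
    · refine lp.single_apply_ne _ _ _ fun h0 => hn ?_
      have := congrArg ULift.down h0
      simpa using this
  change inner ℂ (lp.single 2 0 1 : EllTwoInt.{u}) (T (lp.single 2 0 1)) = _
  rw [hT, lp.inner_single_left]
  change inner ℂ (1 : ℂ) (f ((h ^ (0 : ℤ)) w) *
    (bilateralShift n (lp.single 2 0 1 : EllTwoInt.{u})) 0) = _
  rw [hδ]
  simp

/-- The canonical conditional expectation of the crossed product onto `C(W)`. -/
def CrossedProduct.expectation : CrossedProduct h →L[ℂ] C(W, ℂ) :=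
  LinearMap.mkContinuous
    { toFun := fun a => ⟨orbitCoefficient h a, by
        refine CrossedProduct.induction h (p := fun a => Continuous (orbitCoefficient h a))
          (isClosed_continuous_orbitCoefficient h) ?_ ?_ a
        · intro a b ha hb
          exact (ha.add hb).congr fun w => (orbitCoefficient_add h a b w).symm
        · intro b f n hb
          have : orbitCoefficient h b = fun w => if n = 0 then f w else 0 :=
            funext (orbitCoefficient_monomial h f n b hb)
          rw [this]
          split_ifs
          · exact f.continuous
          · exact continuous_const⟩
      map_add' := fun a b => by ext w; exact orbitCoefficient_add h a b w
      map_smul' := fun r a => by ext w; exact orbitCoefficient_smul h r a w } 1 fun a => by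
    rw [one_mul, ContinuousMap.norm_le _ (norm_nonneg _)]
    exact norm_orbitCoefficient_le h a

@[simp]
theorem CrossedProduct.expectation_apply (a : CrossedProduct h) (w : W) :
    CrossedProduct.expectation h a w = orbitCoefficient h a w := rfl

theorem CrossedProduct.expectation_monomial (f : C(W, ℂ)) (n : ℤ) (a : CrossedProduct h)
    (ha : a.1 = universalFnHom h f * (universalU h ^ n : unitary (CovariantProduct h))) :
    CrossedProduct.expectation h a = if n = 0 then f else 0 := by
  ext w
  rw [expectation_apply, orbitCoefficient_monomial h f n a ha]
  split_ifs <;> rfl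

theorem CrossedProduct.expectation_fn (f : C(W, ℂ)) :
    CrossedProduct.expectation h (CrossedProduct.fn h f) = f := by
  rw [expectation_monomial h f 0 _ (by rw [zpow_zero, Submonoid.coe_one, mul_one]; rfl), if_pos rfl]

variable {h}

/-- Vector states are positive, so the function is pointwise nonnegative and has a continuous square
root. Positivity of a functional on squares thus passes through `E`. -/
theorem CrossedProduct.expectation_star_mul_self (a : CrossedProduct h) :
    ∃ q : C(W, ℂ), CrossedProduct.expectation h (star a * a) = star q * q := by
  refine ⟨⟨fun w => ((Real.sqrt (CrossedProduct.expectation h (star a * a) w).re : ℝ) : ℂ),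
    by fun_prop⟩, ?_⟩
  ext w
  obtain ⟨h1, h2⟩ := Complex.le_def.1 (orbitCoefficient_star_mul_self h a w)
  apply Complex.ext
  · simpa using (Real.mul_self_sqrt h1).symm
  · simpa using h2.symm

/-- Both sides are continuous and additive in each variable, so monomials `f u ^ m` and `g u ^ n`
suffice, and only `m + n = 0` contributes. -/
theorem CrossedProduct.apply_expectation_mul_comm {φ : C(W, ℂ) →L[ℂ] ℂ}
    (hinv : ∀ f, φ (twist h 1 f) = φ f) (a b : CrossedProduct h) :
    φ (CrossedProduct.expectation h (a * b)) = φ (CrossedProduct.expectation h (b * a)) := by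
  have hinv' : ∀ (n : ℤ) f, φ (twist h n f) = φ f := by
    intro n
    induction n with
    | zero => intro f; rw [twist_zero]
    | succ n ih => intro f; rw [← twist_twist, ih, hinv]
    | pred n ih =>
      intro f
      rw [sub_eq_add_neg, ← twist_twist, ih, ← hinv, twist_twist, add_neg_cancel, twist_zero]
  have hcont : Continuous fun a => φ (CrossedProduct.expectation h a) :=
    φ.continuous.comp (CrossedProduct.expectation h).continuous
  refine CrossedProduct.induction h (p := fun a => φ (CrossedProduct.expectation h (a * b)) =
    φ (CrossedProduct.expectation h (b * a))) ?_ ?_ ?_ a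
  · exact isClosed_eq (hcont.comp (continuous_mul_const b)) (hcont.comp (continuous_const_mul b))
  · intro a a' ha ha'
    rw [add_mul, mul_add, map_add, map_add, map_add, map_add, ha, ha']
  · intro a f m ha
    refine CrossedProduct.induction h (p := fun b => φ (CrossedProduct.expectation h (a * b)) =
      φ (CrossedProduct.expectation h (b * a))) ?_ ?_ ?_ b
    · exact isClosed_eq (hcont.comp (continuous_const_mul a)) (hcont.comp (continuous_mul_const a))
    · intro b b' hb hb'
      rw [add_mul, mul_add, map_add, map_add, map_add, map_add, hb, hb']
    · intro b g n hb
      rw [CrossedProduct.expectation_monomial h (f * twist h m g) (m + n) (a * b),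
        CrossedProduct.expectation_monomial h (g * twist h n f) (n + m) (b * a), add_comm n m]
      · split_ifs with h0
        -- Applying `twist h n` to `f * twist h m g` gives `twist h n f * g`, because `m + n = 0`.
        · rw [← hinv' n (f * _), map_mul (twist h n), twist_twist, add_comm n m, h0, twist_zero,
            mul_comm]
        · rfl
      · change b.1 * a.1 = _
        rw [ha, hb, mul_unitary_zpow_mul (universal_covariant h)]
      · change a.1 * b.1 = _
        rw [ha, hb, mul_unitary_zpow_mul (universal_covariant h)]

/-- The trace `φ ∘ E` on the crossed product induced by an invariant state `φ` of `C(W)`. -/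
def CrossedProduct.inducedTrace (φ : C(W, ℂ) →L[ℂ] ℂ) (hpos : ∀ g, 0 ≤ φ (star g * g))
    (hone : φ 1 = 1) (hinv : ∀ f, φ (twist h 1 f) = φ f) : TracialState (CrossedProduct h) where
  functional := φ.comp (CrossedProduct.expectation h)
  nonneg a := by
    obtain ⟨q, hq⟩ := CrossedProduct.expectation_star_mul_self a
    change 0 ≤ φ (CrossedProduct.expectation h (star a * a))
    rw [hq]
    exact hpos q
  map_one := by
    change φ (CrossedProduct.expectation h 1) = 1
    rw [← show CrossedProduct.fn h 1 = 1 from map_one (CrossedProduct.fnHom h),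
      CrossedProduct.expectation_fn, hone]
  map_mul_comm := CrossedProduct.apply_expectation_mul_comm hinv

/-- Both algebras contain `C(W)`, which determines traces; this gives injectivity. For surjectivity,
`φ ∘ E` with `φ` the restriction of `σ` to `C(W)` agrees with `σ` there. -/
theorem OrbitBreaking.restrictTrace_bijective_of_invariant {Z : Set W}
    (hfree : ∀ n : ℤ, n ≠ 0 → ∀ w, ∃ p : C(W, ℂ),
      IsStarProjection p ∧ p w = 1 ∧ p * twist h n p = 0)
    (hinv : ∀ (τ : TracialState (OrbitBreaking h Z)) f,
      τ (OrbitBreaking.fnHom h Z (twist h 1 f)) = τ (OrbitBreaking.fnHom h Z f)) :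
    Function.Bijective (OrbitBreaking.restrictTrace h Z) := by
  constructor
  · intro τ σ hτσ
    refine TracialState.ext_of_fn (universal_covariant h) hfree (fun f => Or.inl ⟨f, rfl⟩)
      (crossedProductGenerators_form h) (τ := τ) (σ := σ) fun f => ?_
    exact congrArg (fun τ' : TracialState (OrbitBreaking h Z) => τ' (OrbitBreaking.fn h Z f)) hτσ
  · intro σ
    let fnL : C(W, ℂ) →L[ℂ] OrbitBreaking h Z :=
OrbitBreaking.fnCLM h Z
    refine ⟨CrossedProduct.inducedTrace (σ.functional.comp (OrbitBreaking.fnCLM h Z))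
      (fun g => ?_) ?_ (hinv σ), ?_⟩
    · change 0 ≤ σ (OrbitBreaking.fnHom h Z (star g * g))
      rw [map_mul, map_star]
      exact σ.nonneg _
    · change σ (OrbitBreaking.fnHom h Z 1) = 1
      rw [map_one]
      exact σ.map_one
    · refine TracialState.ext_of_fn (CrossedProduct.covariant h) hfree (fun f => Or.inl ⟨f, rfl⟩)
        (orbitBreakingGenerators_form h Z) fun f => ?_
      change σ (OrbitBreaking.fnHom h Z (CrossedProduct.expectation h (CrossedProduct.fn h f))) = _
      rw [CrossedProduct.expectation_fn]
      rfl

end CrossedProduct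

/-! ### Aperiodicity and clopen towers in the product system. -/

section ProductSystem

variable {X : Type*} [TopologicalSpace X] {S : Type*} [TopologicalSpace S]

theorem prodCongr_zpow_apply (α : X ≃ₜ X) (β : S ≃ₜ S) (k : ℤ) (w : X × S) :
    ((α.prodCongr β) ^ k) w = ((α ^ k) w.1, (β ^ k) w.2) := by
  have hmul : ∀ (f g : X ≃ₜ X) (f' g' : S ≃ₜ S),
      f.prodCongr f' * g.prodCongr g' = (f * g).prodCongr (f' * g') := fun _ _ _ _ => rfl
  have : (α.prodCongr β) ^ k = (α ^ k).prodCongr (β ^ k) := by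
    induction k with
    | zero => rfl
    | succ k ih => rw [zpow_add_one, zpow_add_one, zpow_add_one, ih, hmul]
    | pred k ih => rw [zpow_sub_one, zpow_sub_one, zpow_sub_one, ih, ← hmul]; rfl
  rw [this]
  rfl

/-- The first factor of a minimal product system over an infinite space has no periodic points. -/
theorem zpow_apply_ne_of_isMinimalHomeo_prod [T1Space X] [PerfectSpace X] [Nonempty S]
    {α : X ≃ₜ X} {β : S ≃ₜ S} (hmin : IsMinimalHomeo (α.prodCongr β)) {k : ℤ} (hk : k ≠ 0)
    (x : X) : (α ^ k) x ≠ x := by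
  intro hfix
  obtain ⟨s⟩ := ‹Nonempty S›
  have hdense : Dense (Set.range fun j : ℤ => (α ^ j) x) := by
    have h1 : DenseRange fun j : ℤ => ((α.prodCongr β) ^ j) (x, s) := hmin (x, s)
    have h2 : Function.Surjective (Prod.fst : X × S → X) := fun x => ⟨(x, s), rfl⟩
    have h3 := h2.denseRange.comp h1 continuous_fst
    have h4 : (Prod.fst ∘ fun j : ℤ => ((α.prodCongr β) ^ j) (x, s)) = fun j : ℤ => (α ^ j) x := by
      ext j
      simp [prodCongr_zpow_apply]
    rwa [h4] at h3
  have hper : ∀ m : ℤ, (α ^ (k * m)) x = x := by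
    intro m
    rw [zpow_mul]
    induction m with
    | zero => rfl
    | succ m ih => rw [zpow_add_one, Homeomorph.mul_apply, hfix, ih]
    | pred m ih =>
      rw [zpow_sub_one, Homeomorph.mul_apply]
      have : (α ^ k)⁻¹ x = x := (α ^ k).symm_apply_eq.2 hfix.symm
      rw [this, ih]
  have hfin : (Set.range fun j : ℤ => (α ^ j) x).Finite := by
    refine ((Set.finite_Ico (0 : ℤ) |k|).image fun j : ℤ => (α ^ j) x).subset ?_
    rintro _ ⟨j, rfl⟩
    refine ⟨j % k, ⟨Int.emod_nonneg j hk, Int.emod_lt_abs j hk⟩, ?_⟩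
    change (α ^ (j % k)) x = (α ^ j) x
    conv_rhs => rw [← Int.emod_add_mul_ediv j k, zpow_add, Homeomorph.mul_apply, hper]
  -- A finite set is closed in a T1 space, so the dense finite orbit is all of `X`, which is then
  -- discrete.
  have huniv : (Set.univ : Set X).Finite := by
    rwa [← hdense.closure_eq, hfin.isClosed.closure_eq]
  have : Finite X := Set.finite_univ_iff.1 huniv
  have hopen : IsOpen ({x} : Set X) := isOpen_discrete _
  exact (PerfectSpace.not_isolated x).ne (isOpen_singleton_iff_punctured_nhds x |>.1 hopen)

/-- The indicator function of a clopen set of `X`, as a function on `X × S`. -/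
def clopenIndicator (S : Type*) [TopologicalSpace S] {P : Set X} (hP : IsClopen P) :
    C(X × S, ℂ) :=
  (LocallyConstant.charFn ℂ hP : C(X, ℂ)).comp ⟨Prod.fst, continuous_fst⟩

open Classical in
theorem clopenIndicator_apply {P : Set X} (hP : IsClopen P) (w : X × S) :
    clopenIndicator S hP w = if w.1 ∈ P then 1 else 0 := by
  simp [clopenIndicator, LocallyConstant.coe_charFn, Set.indicator_apply]

theorem isStarProjection_clopenIndicator {P : Set X} (hP : IsClopen P) :
    IsStarProjection (clopenIndicator S hP) := by
  classical
  constructor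
  · ext w
    simp [clopenIndicator_apply]
  · ext w
    by_cases hw : w.1 ∈ P <;> simp [clopenIndicator_apply, hw]

/-- The product is nonzero at `w` only if `w.1` and `α ^ (-k) w.1` both lie in `P`; the hypothesis
at the latter point excludes this. -/
theorem clopenIndicator_mul_twist_eq_zero {α : X ≃ₜ X} {β : S ≃ₜ S} {P : Set X} (hP : IsClopen P)
    {k : ℤ} (hdis : ∀ x ∈ P, (α ^ k) x ∉ P) :
    clopenIndicator S hP * twist (α.prodCongr β) k (clopenIndicator S hP) = 0 := by
  classical
  ext w
  have : w.1 ∈ P → (α ^ (-k)) w.1 ∉ P := by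
    intro h1 h2
    refine hdis _ h2 ?_
    rwa [← Homeomorph.mul_apply, ← zpow_add, add_neg_cancel, zpow_zero, Homeomorph.one_apply]
  simp only [ContinuousMap.mul_apply, twist_apply, clopenIndicator_apply, prodCongr_zpow_apply,
    ContinuousMap.zero_apply]
  by_cases h1 : w.1 ∈ P
  · rw [if_neg (this h1), mul_zero]
  · rw [if_neg h1, zero_mul]

/-- A clopen `Q` separating `x` from `α x` is cut down to the points that `α` sends out of `Q`. -/
theorem exists_isClopen_disjoint_translate [TotallySeparatedSpace X] {α : X ≃ₜ X} {x : X}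
    (hx : α x ≠ x) : ∃ P : Set X, IsClopen P ∧ x ∈ P ∧ ∀ z ∈ P, α z ∉ P := by
  obtain ⟨Q, hQ, hxQ, hαQ⟩ := exists_isClopen_of_totally_separated hx.symm
  exact ⟨Q ∩ α ⁻¹' Qᶜ, hQ.inter (hQ.compl.preimage α.continuous), ⟨hxQ, hαQ⟩,
    fun z hz hz' => hz.2 hz'.1⟩

theorem exists_isClopen_disjoint_translates [TotallySeparatedSpace X] {α : X ≃ₜ X} {x : X}
    (hx : ∀ k : ℤ, k ≠ 0 → (α ^ k) x ≠ x) (N : ℕ) :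
    ∃ P : Set X, IsClopen P ∧ x ∈ P ∧ ∀ k : ℤ, 1 ≤ k → k ≤ N → ∀ z ∈ P, (α ^ k) z ∉ P := by
  induction N with
  | zero => exact ⟨Set.univ, isClopen_univ, trivial, fun k h1 h2 => by omega⟩
  | succ N ih =>
    obtain ⟨P, hP, hxP, hPk⟩ := ih
    obtain ⟨Q, hQ, hxQ, hQk⟩ := exists_isClopen_disjoint_translate (hx (N + 1) (by omega))
    refine ⟨P ∩ Q, hP.inter hQ, ⟨hxP, hxQ⟩, fun k h1 h2 z hz hz' => ?_⟩
    rcases (show k ≤ N ∨ k = N + 1 by push_cast at h2; omega) with hk | rfl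
    · exact hPk k h1 hk z hz.1 hz'.1
    · exact hQk z hz.2 hz'.2

end ProductSystem

end

theorem proposition3p3 {X : Type u} [TopologicalSpace X]
    -- `X` is a Cantor set (nonempty because of `y`)
    [CompactSpace X] [TopologicalSpace.MetrizableSpace X] [TotallyDisconnectedSpace X]
    [PerfectSpace X]
    (n : ℕ) (hn : 3 ≤ n) (hodd : Odd n)
    (α : X ≃ₜ X) (β : Sphere n ≃ₜ Sphere n)
    (hmin : IsMinimalHomeo (α.prodCongr β)) (y : X) :
    (∀ (τ : TracialState (OrbitBreaking (α.prodCongr β) (fibreOver (Sphere n) {y})))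
        (f : C(X × Sphere n, ℂ)),
      τ (OrbitBreaking.fn (α.prodCongr β) (fibreOver (Sphere n) {y})
          (f.comp ((α.prodCongr β).symm : C(X × Sphere n, X × Sphere n)))) =
        τ (OrbitBreaking.fn (α.prodCongr β) (fibreOver (Sphere n) {y}) f)) ∧
    Function.Bijective
      (OrbitBreaking.restrictTrace (α.prodCongr β) (fibreOver (Sphere n) {y})) := by
  classical
  have hne : Nonempty (Sphere n) := (NormedSpace.sphere_nonempty.2 zero_le_one).to_subtype
  have haper : ∀ k : ℤ, k ≠ 0 → ∀ x, (α ^ k) x ≠ x := fun k hk x =>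
    zpow_apply_ne_of_isMinimalHomeo_prod hmin hk x
  have hinv : ∀ (τ : TracialState (OrbitBreaking (α.prodCongr β) (fibreOver (Sphere n) {y})))
      (f : C(X × Sphere n, ℂ)),
      τ (OrbitBreaking.fnHom (α.prodCongr β) (fibreOver (Sphere n) {y})
        (twist (α.prodCongr β) 1 f)) =
      τ (OrbitBreaking.fnHom (α.prodCongr β) (fibreOver (Sphere n) {y}) f) := by
    intro τ
    refine twist_one_invariant_of_towers (α.prodCongr β)
      (τ.functional.comp (OrbitBreaking.fnCLM (α.prodCongr β) (fibreOver (Sphere n) {y})))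
      (fibreOver (Sphere n) {y})
      (OrbitBreaking.trace_twist_one_of_vanishing (α.prodCongr β) (fibreOver (Sphere n) {y}) τ)
      fun N => ?_
    -- The indicator of `P × S^n` is `1` on the fibre over `y` and inherits disjoint translates from
    -- `P`.
    obtain ⟨P, hP, hyP, hdis⟩ := exists_isClopen_disjoint_translates (fun k hk => haper k hk y) N
    refine ⟨clopenIndicator (Sphere n) hP, isStarProjection_clopenIndicator hP, ?_,
      fun k h1 h2 => clopenIndicator_mul_twist_eq_zero hP (hdis k h1 h2)⟩
    rintro z ⟨hz, -⟩
    rw [Set.mem_singleton_iff] at hz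
    rw [clopenIndicator_apply, if_pos (hz ▸ hyP)]
  refine ⟨fun τ f => ?_, OrbitBreaking.restrictTrace_bijective_of_invariant ?_ hinv⟩
  · have := hinv τ f
    rw [twist_one] at this
    exact this
  · intro k hk w
    obtain ⟨P, hP, hwP, hdis⟩ := exists_isClopen_disjoint_translate (haper k hk w.1)
    exact ⟨clopenIndicator (Sphere n) hP, isStarProjection_clopenIndicator hP,
      by rw [clopenIndicator_apply, if_pos hwP], clopenIndicator_mul_twist_eq_zero hP hdis⟩
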